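/- Open mapping theorem. Let $\mathbb{K}$ be $\mathbb{R}$ or $\mathbb{C}$, and let $X$ and $Y$ be separated (Hausdorff) locally convex topological vector spaces over $\mathbb{K}$. Assume that $X$ is barrelled (every closed, absolutely convex, absorbing subset of $X$ is a neighbourhood of zero; equivalently, every lower semicontinuous seminorm on $X$ is continuous). Assume that $Y$ is fully complete (a Ptak space): a linear subspace $M$ of the continuous dual $Y'$ is weak-$*$ closed whenever $M \cap U^{\circ}$ is weak-$*$ closed for every neighbourhood $U$ of zero in $Y$, where $U^{\circ} = \{ f \in Y' : |f(y)| \leq 1 \text{ for all } y \in U \}$. If $\psi : Y \to X$ is a surjective linear map whose graph $\{(y, x) \in Y \times X : x = \psi(y)\}$ is closed in $Y \times X$, then $\psi$ is open: $\psi(B)$ is open in $X$ for every open $B \subseteq Y$. -/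

import Mathlib

open Topology

/-- A separated locally convex space `E` over `𝕜 = ℝ` or `ℂ` is *fully complete* (also called a
Ptak space or a `B`-complete space) if a vector subspace `M` of its continuous dual is weak-*
closed as soon as, for every neighbourhood `U` of zero in `E`, the intersection of `M` with the
polar `{f | ∀ x ∈ U, ‖f x‖ ≤ 1}` is weak-* closed. -/
structure FullyCompleteSpace (𝕜 E : Type*) [RCLike 𝕜] [AddCommGroup E] [Module 𝕜 E]
    [Module ℝ E] [IsScalarTower ℝ 𝕜 E] [TopologicalSpace E] [IsTopologicalAddGroup E]
    [ContinuousSMul 𝕜 E] [LocallyConvexSpace ℝ E] : Prop where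
  t2Space : T2Space E
  isClosed_of_inter_polar : ∀ M : Submodule 𝕜 (WeakDual 𝕜 E),
    (∀ U ∈ 𝓝 (0 : E),
      IsClosed ((M : Set (WeakDual 𝕜 E)) ∩ {f : WeakDual 𝕜 E | ∀ x ∈ U, ‖f x‖ ≤ 1})) →
    IsClosed (M : Set (WeakDual 𝕜 E))

/-! Barrelledness makes `ψ` nearly open: `closure (ψ '' U)` is a neighbourhood of zero. Let `M` be
the space of continuous functionals `f ∘ ψ` with `f ∈ X'`. Near openness makes each `M ∩ U°` weak-*
closed, so `M` is closed by full completeness. The closed graph puts every vector killed by `M` in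
`ker ψ`; by Hahn-Banach, `M` is then the whole annihilator of `ker ψ`. Separation now gives
`ψ⁻¹(closure (ψ U)) ⊆ closure (U + ker ψ) ⊆ U + U + ker ψ` for balanced convex `U`, which upgrades
near openness to openness. -/

open scoped Pointwise

/-- If the real part of a linear functional is bounded above on a subspace, then the functional
vanishes on the subspace. -/
theorem LinearMap.apply_eq_zero_of_forall_mem_re_lt {𝕜 E : Type*} [RCLike 𝕜] [AddCommGroup E]
    [Module 𝕜 E] {M : Submodule 𝕜 E} {l : E →ₗ[𝕜] 𝕜} {u : ℝ}
    (hl : ∀ x ∈ M, RCLike.re (l x) < u) {x : E} (hx : x ∈ M) : l x = 0 := by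
  by_contra hne
  -- The multiple is chosen so that `l` takes the excluded value `u`.
  have := hl (((u : 𝕜) * (l x)⁻¹) • x) (M.smul_mem _ hx)
  rw [map_smul, smul_eq_mul, mul_assoc, inv_mul_cancel₀ hne, mul_one, RCLike.ofReal_re] at this
  exact this.false

/-- In a locally convex space, a closed subspace and a point outside it are separated by a
continuous linear functional vanishing on the subspace. -/
theorem Submodule.exists_strongDual_eq_zero_apply_ne_zero {𝕜 E : Type*} [RCLike 𝕜]
    [AddCommGroup E] [Module 𝕜 E] [Module ℝ E] [IsScalarTower ℝ 𝕜 E] [TopologicalSpace E]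
    [IsTopologicalAddGroup E] [ContinuousSMul 𝕜 E] [LocallyConvexSpace ℝ E]
    {M : Submodule 𝕜 E} (hM : IsClosed (M : Set E)) {x : E} (hx : x ∉ M) :
    ∃ l : StrongDual 𝕜 E, (∀ y ∈ M, l y = 0) ∧ l x ≠ 0 := by
  obtain ⟨l, u, hlt, hu⟩ := RCLike.geometric_hahn_banach_closed_point (𝕜 := 𝕜)
    (M.restrictScalars ℝ).convex hM hx
  refine ⟨l, fun y hy => LinearMap.apply_eq_zero_of_forall_mem_re_lt (l := l.toLinearMap) hlt hy,
    fun h0 => ?_⟩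
  have hu0 : 0 < u := by simpa using hlt 0 M.zero_mem
  rw [h0, map_zero] at hu
  exact hu.not_gt hu0

/-- A closed subspace of a space with the weak topology of a pairing and a point outside it are
separated by a vector of the other space. -/
theorem WeakBilin.exists_forall_eq_zero_apply_ne_zero {𝕜 E F : Type*} [RCLike 𝕜] [AddCommGroup E]
    [Module 𝕜 E] [AddCommGroup F] [Module 𝕜 F] (B : E →ₗ[𝕜] F →ₗ[𝕜] 𝕜)
    {M : Submodule 𝕜 (WeakBilin B)} (hM : IsClosed (M : Set (WeakBilin B)))
    {g : WeakBilin B} (hg : g ∉ M) : ∃ x : F, (∀ h ∈ M, WeakBilin.eval B x h = 0) ∧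
      WeakBilin.eval B x g ≠ 0 := by
  let : Module ℝ E := .restrictScalars ℝ 𝕜 E
  have : IsScalarTower ℝ 𝕜 E := .restrictScalars ℝ 𝕜 E
  let : Module ℝ (WeakBilin B) := inferInstanceAs (Module ℝ E)
  have : IsScalarTower ℝ 𝕜 (WeakBilin B) := inferInstanceAs (IsScalarTower ℝ 𝕜 E)
  have : LocallyConvexSpace ℝ (WeakBilin B) := WeakBilin.locallyConvexSpace
  obtain ⟨l, hl, hlg⟩ := Submodule.exists_strongDual_eq_zero_apply_ne_zero hM hg
  obtain ⟨x, rfl⟩ := LinearMap.dualEmbedding_surjective B l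
  exact ⟨x, hl, hlg⟩

/-- A weak-* closed subspace of the dual and a functional outside it are separated by a vector. -/
theorem WeakDual.exists_forall_eq_zero_apply_ne_zero {𝕜 E : Type*} [RCLike 𝕜] [AddCommGroup E]
    [Module 𝕜 E] [TopologicalSpace E]
    {M : Submodule 𝕜 (WeakDual 𝕜 E)} (hM : IsClosed (M : Set (WeakDual 𝕜 E)))
    {g : WeakDual 𝕜 E} (hg : g ∉ M) : ∃ x : E, (∀ h ∈ M, h x = 0) ∧ g x ≠ 0 :=
  WeakBilin.exists_forall_eq_zero_apply_ne_zero (topDualPairing 𝕜 E) hM hg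

/-- A linear functional bounded by `1` on a neighbourhood of zero is continuous. -/
theorem LinearMap.continuous_of_norm_le_one_of_mem_nhds_zero {𝕜 E : Type*} [RCLike 𝕜]
    [AddCommGroup E] [Module 𝕜 E] [TopologicalSpace E] [IsTopologicalAddGroup E]
    [ContinuousSMul 𝕜 E] {f : E →ₗ[𝕜] 𝕜} {V : Set E}
    (hV : V ∈ 𝓝 (0 : E)) (hf : ∀ x ∈ V, ‖f x‖ ≤ 1) : Continuous f :=
  (f.clmOfExistsBoundedImage ⟨V, hV, NormedSpace.isVonNBounded_of_isBounded 𝕜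
    (isBounded_iff_forall_norm_le.2 ⟨1, Set.forall_mem_image.2 hf⟩)⟩).continuous

section LocallyConvex

variable {𝕜 E : Type*} [RCLike 𝕜] [AddCommGroup E] [Module 𝕜 E] [Module ℝ E]
  [IsScalarTower ℝ 𝕜 E] [TopologicalSpace E] [ContinuousSMul 𝕜 E]

variable (𝕜) in
/-- In a locally convex space, the convex balanced neighbourhoods of zero form a base. -/
theorem exists_balanced_convex_mem_nhds_zero_subset [IsTopologicalAddGroup E] [LocallyConvexSpace ℝ E] {U : Set E}
    (hU : U ∈ 𝓝 (0 : E)) : ∃ V ∈ 𝓝 (0 : E), Balanced 𝕜 V ∧ Convex ℝ V ∧ V ⊆ U := by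
  obtain ⟨C, hC, hconv, hCU⟩ :=
    (locallyConvexSpace_iff_exists_convex_subset_zero ℝ E).1 inferInstance U hU
  have hbal : Balanced 𝕜 (convexHull ℝ (balancedCore 𝕜 C)) := fun a ha => by
    have := ((a • LinearMap.id : E →ₗ[𝕜] E).restrictScalars ℝ).image_convexHull (balancedCore 𝕜 C)
    exact this.subset.trans (convexHull_mono (balancedCore_balanced C a ha))
  refine ⟨convexHull ℝ (balancedCore 𝕜 C),
    Filter.mem_of_superset (balancedCore_mem_nhds_zero hC) (subset_convexHull ℝ _),
    hbal, convex_convexHull ℝ _,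
    (convexHull_min (balancedCore_subset C) hconv).trans hCU⟩

/-- In a barrelled space over `ℝ` or `ℂ`, every barrel is a neighbourhood of zero. -/
theorem BarrelledSpace.mem_nhds_zero [BarrelledSpace 𝕜 E] {V : Set E} (hbal : Balanced 𝕜 V)
    (hconv : Convex ℝ V) (habs : Absorbent ℝ V) (hV : IsClosed V) : V ∈ 𝓝 (0 : E) := by
  have : ContinuousSMul ℝ E := IsScalarTower.continuousSMul 𝕜
  have h0 : (0 : E) ∈ V := habs.zero_mem
  have hp : Continuous (gaugeSeminorm hbal hconv habs) := by
    refine Seminorm.continuous_of_lowerSemicontinuous _ ?_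
    refine lowerSemicontinuous_iff_isClosed_preimage.2 fun a => ?_
    change IsClosed {x | gauge V x ≤ a}
    rcases lt_or_ge a 0 with ha | ha
    · convert isClosed_empty (X := E)
      exact Set.eq_empty_iff_forall_notMem.2 fun x hx =>
        (ha.trans_le (gauge_nonneg x)).not_ge hx
    -- The sublevel set is the intersection of the closed sets `r • V`, `r > a`.
    · rw [setOfPred_gauge_le_eq hconv h0 habs ha]
      exact isClosed_biInter fun r hr => hV.smul_of_ne_zero (ha.trans_lt hr).ne'
  have : {x | gauge V x < 1} ∈ 𝓝 (0 : E) :=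
    (isOpen_lt hp continuous_const).mem_nhds (by
      change gauge V 0 < 1
      simp)
  exact Filter.mem_of_superset this (setOfPred_gauge_lt_one_subset_self hconv h0 habs)

end LocallyConvex

namespace LinearMap

variable {𝕜 X Y : Type*} [RCLike 𝕜]
  [AddCommGroup X] [Module 𝕜 X] [TopologicalSpace X]
  [AddCommGroup Y] [Module 𝕜 Y] [TopologicalSpace Y]

/-- The range of the transpose of a linear map that need not be continuous: all continuous
functionals on `Y` of the form `f ∘ ψ` with `f` a continuous functional on `X`. -/
def weakDualTransposeRange (ψ : Y →ₗ[𝕜] X) : Submodule 𝕜 (WeakDual 𝕜 Y) where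
  carrier := {g | ∃ f : X →L[𝕜] 𝕜, ∀ y, g y = f (ψ y)}
  add_mem' := by
    rintro a b ⟨f, hf⟩ ⟨h, hh⟩
    exact ⟨f + h, fun y => congrArg₂ (· + ·) (hf y) (hh y)⟩
  zero_mem' := ⟨0, fun _ => rfl⟩
  smul_mem' := by
    rintro c a ⟨f, hf⟩
    exact ⟨c • f, fun y => congrArg (c • ·) (hf y)⟩

/-- For a nearly open surjection, the range of the transpose meets polars of neighbourhoods of
zero in weak-* closed sets. -/
theorem isClosed_weakDualTransposeRange_inter_polar [IsTopologicalAddGroup X]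
    [ContinuousSMul 𝕜 X] {ψ : Y →ₗ[𝕜] X}
    (hsurj : Function.Surjective ψ) {U : Set Y} (hψU : closure (ψ '' U) ∈ 𝓝 (0 : X)) :
    IsClosed ((ψ.weakDualTransposeRange : Set (WeakDual 𝕜 Y)) ∩
      {f : WeakDual 𝕜 Y | ∀ x ∈ U, ‖f x‖ ≤ 1}) := by
  set S := (ψ.weakDualTransposeRange : Set (WeakDual 𝕜 Y)) ∩
    {f : WeakDual 𝕜 Y | ∀ x ∈ U, ‖f x‖ ≤ 1} with hS
  -- A bound on `U` alone would not suffice: the factor of `g` through `ψ` must be bounded on a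
  -- neighbourhood of zero in `X`.
  have hle : ∀ g ∈ closure S, ∀ y, ψ y ∈ closure (ψ '' U) → ‖g y‖ ≤ 1 := by
    intro g hg y hy
    refine closure_minimal (t := {g : WeakDual 𝕜 Y | ‖g y‖ ≤ 1}) ?_
      (isClosed_le (WeakDual.eval_continuous y).norm continuous_const) hg
    rintro h ⟨⟨f, hf⟩, hU⟩
    have : closure (ψ '' U) ⊆ {x | ‖f x‖ ≤ 1} := by
      refine closure_minimal ?_ (isClosed_le f.continuous.norm continuous_const)
      rintro _ ⟨z, hz, rfl⟩
      simpa only [Set.mem_ofPred_eq, ← hf z] using hU z hz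
    change ‖h y‖ ≤ 1
    rw [hf y]
    exact this hy
  refine isClosed_of_closure_subset fun g hg => ⟨?_, fun x hx =>
    hle g hg x (subset_closure (Set.mem_image_of_mem ψ hx))⟩
  have hker : ∀ y ∈ ker ψ, g y = 0 := by
    intro y hy
    refine closure_minimal (t := {g : WeakDual 𝕜 Y | g y = 0}) ?_
      (isClosed_eq (WeakDual.eval_continuous y) continuous_const) hg
    rintro h ⟨⟨f, hf⟩, -⟩
    change h y = 0
    rw [hf y, mem_ker.1 hy, map_zero]
  obtain ⟨f, hf⟩ : (WeakDual.toStrongDual g).toLinearMap ∈ range ψ.dualMap := by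
    rw [range_dualMap_eq_dualAnnihilator_ker, Submodule.mem_dualAnnihilator]
    exact hker
  have hfg : ∀ y, f (ψ y) = g y := fun y => DFunLike.congr_fun hf y
  refine ⟨⟨f, continuous_of_norm_le_one_of_mem_nhds_zero hψU fun x hx => ?_⟩,
    fun y => (hfg y).symm⟩
  obtain ⟨y, rfl⟩ := hsurj x
  rw [hfg]
  exact hle g hg y hx

variable [Module ℝ Y] [IsScalarTower ℝ 𝕜 Y] [IsTopologicalAddGroup Y] [ContinuousSMul 𝕜 Y]
  [LocallyConvexSpace ℝ Y]

/-- If every continuous functional vanishing on `ker ψ` factors through a continuous functional on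
`X`, then `ψ⁻¹(closure (ψ U)) ⊆ closure (U + ker ψ)` for `U` convex. -/
theorem mem_closure_add_ker_of_mem_closure_image {ψ : Y →ₗ[𝕜] X}
    (hψ : ∀ g : WeakDual 𝕜 Y, (∀ y ∈ ker ψ, g y = 0) → g ∈ ψ.weakDualTransposeRange)
    {U : Set Y} (hU : Convex ℝ U) (h0 : (0 : Y) ∈ U) {y : Y} (hy : ψ y ∈ closure (ψ '' U)) :
    y ∈ closure (U + (ker ψ : Set Y)) := by
  have : ContinuousSMul ℝ Y := IsScalarTower.continuousSMul 𝕜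
  by_contra hne
  have hconv : Convex ℝ (closure (U + (ker ψ : Set Y))) :=
    (hU.add ((ker ψ).restrictScalars ℝ).convex).closure
  obtain ⟨l, u, hlt, hu⟩ :=
    RCLike.geometric_hahn_banach_closed_point (𝕜 := 𝕜) hconv isClosed_closure hne
  have hlt' : ∀ a ∈ U, ∀ b ∈ ker ψ, RCLike.re (l (a + b)) < u := fun a ha b hb =>
    hlt _ (subset_closure (Set.add_mem_add ha hb))
  -- Bounded above on `U + ker ψ` with `0 ∈ U`, `l` vanishes on `ker ψ` and so descends to `X`.
  obtain ⟨f, hf⟩ := hψ (StrongDual.toWeakDual l) fun z hz =>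
    apply_eq_zero_of_forall_mem_re_lt (l := l.toLinearMap)
      (fun b hb => by simpa using hlt' 0 h0 b hb) hz
  have hf : ∀ z, l z = f (ψ z) := hf
  have hsub : closure (ψ '' U) ⊆ {x | RCLike.re (f x) ≤ u} := by
    refine closure_minimal ?_
      (isClosed_le (RCLike.continuous_re.comp f.continuous) continuous_const)
    rintro _ ⟨a, ha, rfl⟩
    change RCLike.re (f (ψ a)) ≤ u
    rw [← hf]
    simpa using (hlt' a ha 0 (ker ψ).zero_mem).le
  have : RCLike.re (f (ψ y)) ≤ u := hsub hy
  rw [← hf] at this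
  exact this.not_gt hu

variable [Module ℝ X] [IsScalarTower ℝ 𝕜 X] [IsTopologicalAddGroup X] [ContinuousSMul 𝕜 X]

/-- A linear map of a locally convex space onto a barrelled space is nearly open. -/
theorem closure_image_mem_nhds_zero [BarrelledSpace 𝕜 X] {ψ : Y →ₗ[𝕜] X}
    (hsurj : Function.Surjective ψ) {U : Set Y} (hU : U ∈ 𝓝 (0 : Y)) :
    closure (ψ '' U) ∈ 𝓝 (0 : X) := by
  have : ContinuousSMul ℝ X := IsScalarTower.continuousSMul 𝕜
  have : ContinuousSMul ℝ Y := IsScalarTower.continuousSMul 𝕜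
  obtain ⟨V, hV, hbal, hconv, hVU⟩ := exists_balanced_convex_mem_nhds_zero_subset 𝕜 hU
  refine Filter.mem_of_superset ?_ (closure_mono (Set.image_mono hVU))
  have himg : Balanced 𝕜 (ψ '' V) := by
    rintro a ha _ ⟨_, ⟨y, hy, rfl⟩, rfl⟩
    exact ⟨a • y, hbal a ha (Set.smul_mem_smul_set hy), map_smul ψ a y⟩
  have habs : Absorbent ℝ (ψ '' V) := fun x => by
    obtain ⟨y, rfl⟩ := hsurj x
    filter_upwards [absorbent_nhds_zero (𝕜 := ℝ) hV y] with a ha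
    rintro _ rfl
    obtain ⟨z, hz, rfl⟩ := ha rfl
    exact ⟨ψ z, Set.mem_image_of_mem ψ hz, ((ψ.restrictScalars ℝ).map_smul a z).symm⟩
  exact BarrelledSpace.mem_nhds_zero himg.closure
    (hconv.linear_image (ψ.restrictScalars ℝ)).closure (habs.mono subset_closure) isClosed_closure

/-- If `ψ` has closed graph, then the continuous functionals `f` on `X` with `f ∘ ψ` continuous
separate the points of `X`. -/
theorem mem_ker_of_forall_mem_weakDualTransposeRange [LocallyConvexSpace ℝ X] {ψ : Y →ₗ[𝕜] X}
    (hclosed : IsClosed {p : Y × X | p.2 = ψ p.1}) {y : Y}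
    (hy : ∀ g ∈ ψ.weakDualTransposeRange, g y = 0) : y ∈ ker ψ := by
  by_contra hne
  let G : Submodule 𝕜 (Y × X) := ker (LinearMap.snd 𝕜 Y X - ψ.comp (LinearMap.fst 𝕜 Y X))
  have hG : ∀ p : Y × X, p ∈ G ↔ p.2 = ψ p.1 := fun p => sub_eq_zero
  have hGclosed : IsClosed (G : Set (Y × X)) := by
    convert hclosed using 1
    exact Set.ext hG
  have hmem : ((0, ψ y) : Y × X) ∉ G := fun h =>
    hne (mem_ker.2 (((hG _).1 h).trans (map_zero ψ)))
  obtain ⟨l, hl, hly⟩ := Submodule.exists_strongDual_eq_zero_apply_ne_zero hGclosed hmem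
  have hl : ∀ z, l (z, ψ z) = 0 := fun z => hl _ ((hG _).2 rfl)
  have hsplit : ∀ z x, l (z, x) = l (z, 0) + l (0, x) := fun z x => by
    rw [← map_add, Prod.mk_add_mk, add_zero, zero_add]
  -- Since `l` vanishes on the graph, `l (·, 0) = -l (0, ψ ·)` lies in the transpose range.
  have hg := hy (StrongDual.toWeakDual (l.comp (ContinuousLinearMap.inl 𝕜 Y X)))
    ⟨-(l.comp (ContinuousLinearMap.inr 𝕜 Y X)), fun z =>
      eq_neg_of_add_eq_zero_left ((hsplit z (ψ z)).symm.trans (hl z))⟩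
  have h0 : l (y, 0) = 0 := hg
  exact hly (by simpa [hl, h0] using (hsplit y (ψ y)).symm)

end LinearMap

theorem mainTheorem3 {𝕜 X Y : Type*} [RCLike 𝕜]
    [AddCommGroup X] [Module 𝕜 X] [Module ℝ X] [IsScalarTower ℝ 𝕜 X]
    [TopologicalSpace X] [IsTopologicalAddGroup X] [ContinuousSMul 𝕜 X]
    [LocallyConvexSpace ℝ X] [T2Space X] [BarrelledSpace 𝕜 X]
    [AddCommGroup Y] [Module 𝕜 Y] [Module ℝ Y] [IsScalarTower ℝ 𝕜 Y]
    [TopologicalSpace Y] [IsTopologicalAddGroup Y] [ContinuousSMul 𝕜 Y]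
    [LocallyConvexSpace ℝ Y] (hY : FullyCompleteSpace 𝕜 Y)
    (ψ : Y →ₗ[𝕜] X) (hsurj : Function.Surjective ψ)
    (hclosed : IsClosed {p : Y × X | p.2 = ψ p.1}) :
    IsOpenMap ψ := by
  have hfactor : ∀ g : WeakDual 𝕜 Y, (∀ y ∈ LinearMap.ker ψ, g y = 0) →
      g ∈ ψ.weakDualTransposeRange := by
    intro g hg
    by_contra hne
    have hM := hY.isClosed_of_inter_polar ψ.weakDualTransposeRange fun U hU =>
      LinearMap.isClosed_weakDualTransposeRange_inter_polar hsurj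
        (LinearMap.closure_image_mem_nhds_zero hsurj hU)
    obtain ⟨y, hy, hgy⟩ := WeakDual.exists_forall_eq_zero_apply_ne_zero hM hne
    exact hgy (hg y (LinearMap.mem_ker_of_forall_mem_weakDualTransposeRange hclosed hy))
  rw [IsTopologicalAddGroup.isOpenMap_iff_nhds_zero]
  intro W hW
  obtain ⟨V, hV, hVW⟩ := exists_nhds_zero_half (Filter.mem_map.1 hW)
  obtain ⟨U, hU, hbal, hconv, hUV⟩ := exists_balanced_convex_mem_nhds_zero_subset 𝕜 hV
  refine Filter.mem_of_superset (LinearMap.closure_image_mem_nhds_zero hsurj hU) fun x hx => ?_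
  obtain ⟨y, rfl⟩ := hsurj x
  have hy := LinearMap.mem_closure_add_ker_of_mem_closure_image hfactor hconv
    (mem_of_mem_nhds hU) hx
  -- With `z = a + b` near `y`, `y - b = (y - z) + a ∈ U + U` has the same image as `y`.
  have hnhds : {z | y - z ∈ U} ∈ 𝓝 y :=
    (continuous_const.sub continuous_id).continuousAt.preimage_mem_nhds (by simpa using hU)
  obtain ⟨_, hz, a, ha, b, hb, rfl⟩ := mem_closure_iff_nhds.1 hy _ hnhds
  have hmem := hVW _ (hUV hz) _ (hUV ha)
  have hsum : y - (a + b) + a = y - b := by abel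
  have hb : ψ b = 0 := hb
  simpa [hsum, hb] using hmem
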